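/- Let $X_1,X_2,\dots$ be i.i.d. nonnegative survival times with distribution function $F$ and density $f$, and let $C_1,C_2,\dots$ be i.i.d. nonnegative censoring times with distribution function $G$ and density $g$; the pairs $(X_i,C_i)$ are independent of each other and $X_i$ is independent of $C_i$. One observes $T_i=\min(X_i,C_i)$, with distribution function $H$, and $\Delta_i=\mathbf 1_{\{X_i\le C_i\}}$. Let $\tau_F,\tau_G,\tau_H$ be the right end points of the supports of $F,G,H$, and assume $\tau_H=\tau_G<\tau_F\le\infty$. Let $\lambda=f/(1-F)$ be the hazard rate of $X_1$, and $$\Lambda_n(t)=\sum_{i=1}^n\frac{\mathbf 1_{\{T_i\le t\}}\Delta_i}{\sum_{j=1}^n\mathbf 1_{\{T_j\ge T_i\}}}$$ the Nelson--Aalen estimator. Let $\tilde\lambda_n$ be the left-hand slope of the greatest convex minorant of $\Lambda_n$ on $[0,\tau_H]$ (the Grenander-type estimator). Let $k$ be a symmetric probability density on $\mathbb R$ vanishing outside $[-1,1]$, let $b_n>0$ satisfy $b_n\to0$ and $nb_n\to\infty$, put $k_b(u)=b^{-1}k(u/b)$, and define for $x\in[0,\tau_H]$ the smoothed Grenander-type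 estimator $$\tilde\lambda_n^{SG}(x)=\int_{(x-b_n)\vee0}^{(x+b_n)\wedge\tau_H}k_{b_n}(x-u)\,\tilde\lambda_n(u)\,du .$$ **Theorem.** Suppose that $\lambda$ is nondecreasing and continuous on $[0,\tau_H)$. Then for each $0<\epsilon<\tau_H$, $$\sup_{x\in[\epsilon,\tau_H-\epsilon]}\bigl|\tilde\lambda_n^{SG}(x)-\lambda(x)\bigr|\to0\qquad\text{as }n\to\infty$$ with probability one. -/

import Mathlib

open MeasureTheory ProbabilityTheory Filter Topology

noncomputable section

namespace RightCensoring

/-- The right end point of the support of a probability law `ν` on the line,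
`sup {t | ν ((-∞, t]) < 1}`, possibly infinite. -/
def upperEndpoint (ν : Measure ℝ) : EReal :=
  sSup ((fun t : ℝ => (t : EReal)) '' {t : ℝ | cdf ν t < 1})

/-- The hazard rate `f / (1 - F)` of a law `ν` with distribution function `F` and density `f`. -/
def hazardRate (ν : Measure ℝ) (f : ℝ → ℝ) (t : ℝ) : ℝ :=
  f t / (1 - cdf ν t)

/-- The follow-up time `min (x, c)`. -/
def followUp (x c : ℝ) : ℝ := min x c

/-- The censoring indicator `1_{x ≤ c}`. -/
def censInd (x c : ℝ) : ℝ := if x ≤ c then 1 else 0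

/-- The Nelson-Aalen estimator computed from the first `n` observations
`(T i, Δ i)`, `i < n`. -/
def nelsonAalen (n : ℕ) (T Δ : ℕ → ℝ) (t : ℝ) : ℝ :=
  ∑ i ∈ Finset.range n,
    ((if T i ≤ t then 1 else 0) * Δ i) /
      ∑ j ∈ Finset.range n, (if T i ≤ T j then (1 : ℝ) else 0)

/-- The greatest convex minorant on the interval `I` of `g`, as the pointwise supremum
of all functions that are convex on `I` and lie below `g` on `I`. -/
def greatestConvexMinorant (I : Set ℝ) (g : ℝ → ℝ) (x : ℝ) : ℝ :=
  sSup {y : ℝ | ∃ φ : ℝ → ℝ, ConvexOn ℝ I φ ∧ (∀ t ∈ I, φ t ≤ g t) ∧ y = φ x}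

/-- The left-hand slope of a function at `u`. -/
def leftSlope (g : ℝ → ℝ) (u : ℝ) : ℝ := derivWithin g (Set.Iic u) u

/-- The Grenander-type estimator of a nondecreasing hazard: the left-hand slope of the
greatest convex minorant on `[0, τ]` of the Nelson-Aalen estimator. -/
def grenander (τ : ℝ) (n : ℕ) (T Δ : ℕ → ℝ) : ℝ → ℝ :=
  leftSlope (greatestConvexMinorant (Set.Icc 0 τ) (nelsonAalen n T Δ))

/-- A standard kernel: a symmetric probability density supported on `[-1, 1]`. -/
structure IsKernel (k : ℝ → ℝ) : Prop where
  measurable : Measurable k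
  nonneg : ∀ u, 0 ≤ k u
  symmetric : ∀ u, k (-u) = k u
  support_subset : Function.support k ⊆ Set.Icc (-1) 1
  integrable : Integrable k
  integral_eq_one : ∫ u, k u = 1

/-- The kernel rescaled with bandwidth `b`. -/
def scaledKernel (k : ℝ → ℝ) (b u : ℝ) : ℝ := 1 / b * k (u / b)

/-- The smoothed Grenander-type estimator at `x`, with kernel `k` and bandwidth `b`. -/
def smoothedGrenander (k : ℝ → ℝ) (b τ : ℝ) (n : ℕ) (T Δ : ℕ → ℝ) (x : ℝ) : ℝ :=
  ∫ u in (max (x - b) 0)..(min (x + b) τ), scaledKernel k b (x - u) * grenander τ n T Δ u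

end RightCensoring

end

/-!
Almost surely, the Nelson-Aalen estimator converges to the cumulative hazard `Λ t = ∫ λ over [0, t]`
at every rational `t ∈ [0, τ)` (`ae_tendsto_nelsonAalen`). Indeed the proportion at risk converges
uniformly to `S = (1 - F)(1 - G)`, which is positive on `[0, t]` because `t < τ = τ_G < τ_F`; so the
estimator is asymptotically the sample mean of `1_{T ≤ t} Δ / S(T)`, whose expectation is `Λ t`
(`integral_uncensored_weight`), and the strong law of large numbers applies.

The rest of the argument is deterministic. Since `λ` is nondecreasing, `Λ` lies above its supporting
lines. A supporting line lowered by `ε` eventually lies below the Nelson-Aalen estimator on all of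
`[0, τ]`: as the estimator is nondecreasing and `[0, τ]` is compact, it suffices to compare the two
at finitely many points. Hence the greatest convex minorants also converge to `Λ`
(`tendsto_greatestConvexMinorant`). Left-hand slopes of convex functions are squeezed between
difference quotients, so they converge to `λ`; as they are monotone and `λ` is continuous, the
convergence is locally uniform on `(0, τ)` (`tendstoLocallyUniformlyOn_leftSlope`).
Averaging against a kernel of vanishing bandwidth preserves this (`tendstoUniformlyOn_smoothing`).
-/

namespace RightCensoring

/-! ### Monotone functions with a continuous limit -/

/-- Monotone functions converging on a dense set to a continuous limit converge locally
uniformly: between two nearby points of the dense set, both the functions and the limit are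
squeezed by their values at these two points. -/
theorem tendstoLocallyUniformlyOn_of_monotoneOn {U D : Set ℝ} (hU : IsOpen U) (hD : Dense D)
    {h : ℕ → ℝ → ℝ} {l : ℝ → ℝ} (hmono : ∀ n, MonotoneOn (h n) U) (hl : ContinuousOn l U)
    (hlim : ∀ x ∈ U ∩ D, Tendsto (fun n => h n x) atTop (𝓝 (l x))) :
    TendstoLocallyUniformlyOn h l atTop U := by
  rw [Metric.tendstoLocallyUniformlyOn_iff]
  intro ε hε x hx
  have hnear : ∀ᶠ y in 𝓝 x, y ∈ U ∧ |l y - l x| < ε / 4 := by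
    have h1 := (hl.continuousAt (hU.mem_nhds hx)).eventually
      (Metric.ball_mem_nhds (l x) (by linarith : 0 < ε / 4))
    filter_upwards [hU.mem_nhds hx, h1] with y hy hy'
    exact ⟨hy, by simpa [Real.dist_eq] using hy'⟩
  obtain ⟨r, hr, hball⟩ := Metric.eventually_nhds_iff.1 hnear
  obtain ⟨p, hpD, hp1, hp2⟩ := hD.exists_between (show x - r < x by linarith)
  obtain ⟨q, hqD, hq1, hq2⟩ := hD.exists_between (show x < x + r by linarith)
  have hnb : ∀ y ∈ Set.Icc p q, y ∈ U ∧ |l y - l x| < ε / 4 := fun y hy =>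
    hball (by rw [Real.dist_eq, abs_lt]; constructor <;> linarith [hy.1, hy.2])
  have hp := hnb p ⟨le_rfl, by linarith⟩
  have hq := hnb q ⟨by linarith, le_rfl⟩
  refine ⟨Set.Icc p q, mem_nhdsWithin_of_mem_nhds (Icc_mem_nhds hp2 hq1), ?_⟩
  have e1 := (hlim p ⟨hp.1, hpD⟩).eventually (Metric.ball_mem_nhds _ (by linarith : 0 < ε / 4))
  have e2 := (hlim q ⟨hq.1, hqD⟩).eventually (Metric.ball_mem_nhds _ (by linarith : 0 < ε / 4))
  filter_upwards [e1, e2] with n h1 h2 y hy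
  have hyb := hnb y hy
  have m1 := hmono n hp.1 hyb.1 hy.1
  have m2 := hmono n hyb.1 hq.1 hy.2
  have h1' : |h n p - l p| < ε / 4 := by simpa [Real.dist_eq] using h1
  have h2' : |h n q - l q| < ε / 4 := by simpa [Real.dist_eq] using h2
  have a := abs_lt.1 h1'
  have b := abs_lt.1 h2'
  have c := abs_lt.1 hp.2
  have d := abs_lt.1 hq.2
  have e := abs_lt.1 hyb.2
  rw [Real.dist_eq, abs_lt]
  constructor <;> linarith

/-! ### Greatest convex minorants and their left-hand slopes -/

/-- Nonnegativity of `g` makes `0` a convex minorant, so that the supremum is over a nonempty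
set. -/
theorem greatestConvexMinorant_le {I : Set ℝ} {g : ℝ → ℝ} (hg : ∀ t ∈ I, 0 ≤ g t) (hI : Convex ℝ I)
    {x : ℝ} (hx : x ∈ I) : greatestConvexMinorant I g x ≤ g x := by
  refine csSup_le ⟨0, fun _ => 0, convexOn_const 0 hI, hg, rfl⟩ ?_
  rintro _ ⟨φ, -, hle, rfl⟩
  exact hle x hx

theorem le_greatestConvexMinorant {I : Set ℝ} {g φ : ℝ → ℝ} (hφ : ConvexOn ℝ I φ)
    (hle : ∀ t ∈ I, φ t ≤ g t) {x : ℝ} (hx : x ∈ I) : φ x ≤ greatestConvexMinorant I g x := by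
  refine le_csSup ⟨g x, ?_⟩ ⟨φ, hφ, hle, rfl⟩
  rintro _ ⟨ψ, -, hψ, rfl⟩
  exact hψ x hx

theorem convexOn_greatestConvexMinorant {I : Set ℝ} {g : ℝ → ℝ} (hg : ∀ t ∈ I, 0 ≤ g t)
    (hI : Convex ℝ I) : ConvexOn ℝ I (greatestConvexMinorant I g) := by
  refine ⟨hI, fun x hx y hy a b ha hb hab => ?_⟩
  refine csSup_le ⟨0, fun _ => 0, convexOn_const 0 hI, hg, rfl⟩ ?_
  rintro _ ⟨φ, hφ, hle, rfl⟩
  refine (hφ.2 hx hy ha hb hab).trans ?_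
  simp only [smul_eq_mul]
  gcongr
  · exact le_greatestConvexMinorant hφ hle hx
  · exact le_greatestConvexMinorant hφ hle hy

/-- `leftSlope` uses the closed half-line, Mathlib's left derivatives of convex functions the open
one; the two derivatives agree. -/
theorem leftSlope_eq (G : ℝ → ℝ) (u : ℝ) : leftSlope G u = derivWithin G (Set.Iio u) u := by
  refine derivWithin_congr_set' u ?_
  filter_upwards [self_mem_nhdsWithin] with x hx
  exact propext ⟨fun h => lt_of_le_of_ne h hx, fun h => le_of_lt h⟩

theorem monotoneOn_leftSlope {τ : ℝ} {G : ℝ → ℝ} (hG : ConvexOn ℝ (Set.Icc 0 τ) G) :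
    MonotoneOn (leftSlope G) (Set.Ioo 0 τ) := by
  intro x hx y hy hxy
  rw [leftSlope_eq, leftSlope_eq]
  exact hG.monotoneOn_leftDeriv (by rwa [interior_Icc]) (by rwa [interior_Icc]) hxy

theorem le_leftSlope {τ : ℝ} {G : ℝ → ℝ} (hG : ConvexOn ℝ (Set.Icc 0 τ) G) {v u : ℝ} (hv : 0 ≤ v)
    (hvu : v < u) (hu : u < τ) : G u - G v ≤ leftSlope G u * (u - v) := by
  have h := hG.slope_le_leftDeriv_of_mem_interior (x := v) (y := u) ⟨hv, by linarith⟩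
    (by rw [interior_Icc]; exact ⟨by linarith, hu⟩) hvu
  rw [slope_def_field, ← leftSlope_eq, div_le_iff₀ (by linarith)] at h
  exact h

theorem leftSlope_le {τ : ℝ} {G : ℝ → ℝ} (hG : ConvexOn ℝ (Set.Icc 0 τ) G) {u w : ℝ} (hu : 0 < u)
    (huw : u < w) (hw : w < τ) : leftSlope G u * (w - u) ≤ G w - G u := by
  have hui : u ∈ interior (Set.Icc 0 τ) := by rw [interior_Icc]; exact ⟨hu, by linarith⟩
  have h := (hG.leftDeriv_le_rightDeriv_of_mem_interior hui).trans
    (hG.rightDeriv_le_slope_of_mem_interior hui (y := w) ⟨by linarith, by linarith⟩ huw)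
  rw [slope_def_field, ← leftSlope_eq, le_div_iff₀ (by linarith)] at h
  exact h

/-! ### Convergence of the minorant and of its slopes -/

section Deterministic

variable {τ : ℝ} {D : Set ℝ} {A : ℕ → ℝ → ℝ} {L l : ℝ → ℝ}

/-- If nondecreasing functions `A n ≥ 0` converge on a dense set containing `0` to a function `L`
that lies above the lines of slope `l v` through `(v, L v)`, then so do their greatest convex
minorants. The upper bound is trivial. For the lower bound, the supporting line of `L` at `x`,
lowered by `ε`, eventually lies below `A n` on all of `[0, τ]`: monotonicity of `A n` propagates
the bound from a point of the dense set to everything slightly to its right, including `τ`,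
where no convergence is assumed. -/
theorem tendsto_greatestConvexMinorant (hD : Dense D) (h0D : (0 : ℝ) ∈ D)
    (hA0 : ∀ n t, 0 ≤ A n t) (hA : ∀ n, Monotone (A n))
    (hl0 : ∀ t ∈ Set.Ico 0 τ, 0 ≤ l t)
    (hL : ∀ v u, 0 ≤ v → v ≤ u → u < τ → l v * (u - v) ≤ L u - L v ∧ L u - L v ≤ l u * (u - v))
    (hlim : ∀ t ∈ Set.Ico 0 τ ∩ D, Tendsto (fun n => A n t) atTop (𝓝 (L t)))
    {x : ℝ} (hx : x ∈ Set.Ico 0 τ ∩ D) :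
    Tendsto (fun n => greatestConvexMinorant (Set.Icc 0 τ) (A n) x) atTop (𝓝 (L x)) := by
  obtain ⟨⟨hx0, hxτ⟩, hxD⟩ := hx
  have hxI : x ∈ Set.Icc 0 τ := ⟨hx0, hxτ.le⟩
  have hsub : ∀ t ∈ Set.Ico 0 τ, L x + l x * (t - x) ≤ L t := by
    intro t ht
    rcases le_total x t with h | h
    · linarith [(hL x t hx0 h ht.2).1]
    · linarith [(hL t x ht.1 h hxτ).2]
  have hlx := hl0 x ⟨hx0, hxτ⟩
  have key : ∀ ε > 0, ∀ᶠ n in atTop,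
      L x - ε ≤ greatestConvexMinorant (Set.Icc 0 τ) (A n) x := by
    intro ε hε
    obtain ⟨δ, hδ, hδε⟩ : ∃ δ > 0, l x * δ ≤ ε / 2 := by
      refine ⟨ε / (2 * (l x + 1)), by positivity, ?_⟩
      rw [mul_div_assoc', div_le_iff₀ (by positivity)]
      nlinarith
    have hunif : ∀ᶠ n in atTop, ∀ t ∈ Set.Icc 0 τ, L x + l x * (t - x) - ε ≤ A n t := by
      -- Near any `t₀`, compare `A n` with its value at a point `p ∈ D` at most `δ` to the left;
      -- at `t₀ = 0` this must be `p = 0` itself, which is why `0 ∈ D` is required.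
      have hloc : ∀ t₀ ∈ Set.Icc 0 τ, ∀ᶠ z : ℕ × ℝ in atTop ×ˢ 𝓝 t₀,
          z.2 ∈ Set.Icc 0 τ → L x + l x * (z.2 - x) - ε ≤ A z.1 z.2 := by
        intro t₀ ht₀
        obtain ⟨p, hpD, hp0, hpτ, hpt, hnear⟩ : ∃ p ∈ D, 0 ≤ p ∧ p < τ ∧ t₀ < p + δ ∧
            ∀ᶠ t in 𝓝 t₀, t ∈ Set.Icc 0 τ → p ≤ t := by
          rcases eq_or_lt_of_le ht₀.1 with h | h
          · exact ⟨0, h0D, le_rfl, by linarith, by linarith, Eventually.of_forall fun t ht => ht.1⟩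
          · obtain ⟨p, hpD, hp1, hp2⟩ := hD.exists_between (show max 0 (t₀ - δ) < t₀ by
              rw [max_lt_iff]; constructor <;> linarith)
            rw [max_lt_iff] at hp1
            exact ⟨p, hpD, hp1.1.le, by linarith [ht₀.2], by linarith,
              (lt_mem_nhds hp2).mono fun t ht _ => ht.le⟩
        have hnear2 := hnear.and (gt_mem_nhds hpt)
        have hn := (hlim p ⟨⟨hp0, hpτ⟩, hpD⟩).eventually
          (lt_mem_nhds (show L p - ε / 2 < L p by linarith))
        filter_upwards [hn.prod_mk hnear2] with z hz hzI
        obtain ⟨hz1, hz2, hz3⟩ := hz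
        have e1 := hA z.1 (hz2 hzI)
        have e2 := hsub p ⟨hp0, hpτ⟩
        have e3 : l x * (z.2 - p) ≤ l x * δ := by gcongr; linarith
        nlinarith
      have hprod : ∀ᶠ z : ℕ × ℝ in atTop ×ˢ 𝓝ˢ (Set.Icc 0 τ),
          z.2 ∈ Set.Icc 0 τ → L x + l x * (z.2 - x) - ε ≤ A z.1 z.2 := by
        simpa only [isCompact_Icc.prod_nhdsSet_eq_biSup, eventually_iSup] using hloc
      exact hprod.curry.mono fun n hn t ht => hn.self_of_nhdsSet t ht ht
    filter_upwards [hunif] with n hn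
    have hconv : ConvexOn ℝ (Set.Icc 0 τ) (fun t => L x + l x * (t - x) - ε) := by
      refine ⟨convex_Icc 0 τ, fun a _ b _ s t _ _ hst => le_of_eq ?_⟩
      simp only [smul_eq_mul]
      linear_combination (L x - l x * x - ε) * (-hst)
    simpa using le_greatestConvexMinorant hconv hn hxI
  have hup : ∀ n, greatestConvexMinorant (Set.Icc 0 τ) (A n) x ≤ A n x := fun n =>
    greatestConvexMinorant_le (fun t _ => hA0 n t) (convex_Icc 0 τ) hxI
  refine tendsto_order.2 ⟨fun a ha => ?_, fun a ha => ?_⟩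
  · filter_upwards [key ((L x - a) / 2) (by linarith)] with n hn
    linarith
  · filter_upwards [(tendsto_order.1 (hlim x ⟨⟨hx0, hxτ⟩, hxD⟩)).2 a ha] with n hn
    exact (hup n).trans_lt hn

/-- The left-hand slopes of the minorants converge locally uniformly to the slope `l` of the limit.
A left-hand slope at `u` is squeezed between difference quotients to the left and to the right of
`u`, and these converge to difference quotients of `L`, hence to values close to `l u`. -/
theorem tendstoLocallyUniformlyOn_leftSlope (hD : Dense D) (h0D : (0 : ℝ) ∈ D)
    (hA0 : ∀ n t, 0 ≤ A n t) (hA : ∀ n, Monotone (A n))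
    (hl0 : ∀ t ∈ Set.Ico 0 τ, 0 ≤ l t) (hlc : ContinuousOn l (Set.Ioo 0 τ))
    (hL : ∀ v u, 0 ≤ v → v ≤ u → u < τ → l v * (u - v) ≤ L u - L v ∧ L u - L v ≤ l u * (u - v))
    (hlim : ∀ t ∈ Set.Ico 0 τ ∩ D, Tendsto (fun n => A n t) atTop (𝓝 (L t))) :
    TendstoLocallyUniformlyOn
      (fun n => leftSlope (greatestConvexMinorant (Set.Icc 0 τ) (A n))) l atTop (Set.Ioo 0 τ) := by
  have hG : ∀ n, ConvexOn ℝ (Set.Icc 0 τ) (greatestConvexMinorant (Set.Icc 0 τ) (A n)) := fun n =>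
    convexOn_greatestConvexMinorant (fun t _ => hA0 n t) (convex_Icc 0 τ)
  refine tendstoLocallyUniformlyOn_of_monotoneOn isOpen_Ioo hD
    (fun n => monotoneOn_leftSlope (hG n)) hlc ?_
  rintro u ⟨⟨hu0, huτ⟩, huD⟩
  have hGu := tendsto_greatestConvexMinorant hD h0D hA0 hA hl0 hL hlim ⟨⟨hu0.le, huτ⟩, huD⟩
  have hcu := hlc.continuousAt (Ioo_mem_nhds hu0 huτ)
  refine tendsto_order.2 ⟨fun a ha => ?_, fun a ha => ?_⟩
  · obtain ⟨r, hr, hball⟩ := Metric.eventually_nhds_iff.1 ((tendsto_order.1 hcu).1 a ha)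
    obtain ⟨v, hvD, hv1, hv2⟩ := hD.exists_between (show max 0 (u - r) < u by
      rw [max_lt_iff]; constructor <;> linarith)
    rw [max_lt_iff] at hv1
    have hav : a < l v := hball (by rw [Real.dist_eq, abs_lt]; constructor <;> linarith)
    have hGv := tendsto_greatestConvexMinorant hD h0D hA0 hA hl0 hL hlim
      ⟨⟨hv1.1.le, by linarith⟩, hvD⟩
    have hlow : a * (u - v) < L u - L v :=
      (mul_lt_mul_of_pos_right hav (by linarith)).trans_le (hL v u hv1.1.le hv2.le huτ).1
    filter_upwards [(tendsto_order.1 (hGu.sub hGv)).1 _ hlow] with n hn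
    exact lt_of_mul_lt_mul_right (hn.trans_le (le_leftSlope (hG n) hv1.1.le hv2 huτ))
      (by linarith)
  · obtain ⟨r, hr, hball⟩ := Metric.eventually_nhds_iff.1 ((tendsto_order.1 hcu).2 a ha)
    obtain ⟨w, hwD, hw1, hw2⟩ := hD.exists_between (show u < min τ (u + r) by
      rw [lt_min_iff]; constructor <;> linarith)
    rw [lt_min_iff] at hw2
    have haw : l w < a := hball (by rw [Real.dist_eq, abs_lt]; constructor <;> linarith)
    have hGw := tendsto_greatestConvexMinorant hD h0D hA0 hA hl0 hL hlim
      ⟨⟨by linarith, hw2.1⟩, hwD⟩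
    have hupp : L w - L u < a * (w - u) :=
      ((hL u w hu0.le hw1.le hw2.1).2).trans_lt (mul_lt_mul_of_pos_right haw (by linarith))
    filter_upwards [(tendsto_order.1 (hGw.sub hGu)).2 _ hupp] with n hn
    exact lt_of_mul_lt_mul_right ((leftSlope_le (hG n) hu0 hw1 hw2.1).trans_lt hn)
      (by linarith)

end Deterministic

/-- The supporting-line inequalities for the primitive of a nondecreasing function. -/
theorem integral_bounds_of_monotoneOn {τ : ℝ} {l : ℝ → ℝ} (hl : MonotoneOn l (Set.Ico 0 τ))
    {v u : ℝ} (hv : 0 ≤ v) (hvu : v ≤ u) (hu : u < τ) :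
    l v * (u - v) ≤ (∫ s in (0 : ℝ)..u, l s) - ∫ s in (0 : ℝ)..v, l s ∧
      (∫ s in (0 : ℝ)..u, l s) - ∫ s in (0 : ℝ)..v, l s ≤ l u * (u - v) := by
  have hi : ∀ a b, 0 ≤ a → a ≤ b → b < τ → IntervalIntegrable l volume a b := by
    intro a b ha hab hb
    refine MonotoneOn.intervalIntegrable (hl.mono ?_)
    rw [Set.uIcc_of_le hab]
    exact fun t ht => ⟨ha.trans ht.1, ht.2.trans_lt hb⟩
  rw [intervalIntegral.integral_interval_sub_left (hi 0 u le_rfl (hv.trans hvu) hu)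
    (hi 0 v le_rfl hv (hvu.trans_lt hu))]
  have hvI : v ∈ Set.Ico 0 τ := ⟨hv, hvu.trans_lt hu⟩
  have huI : u ∈ Set.Ico 0 τ := ⟨hv.trans hvu, hu⟩
  have hiu := hi v u hv hvu hu
  constructor
  · calc l v * (u - v) = ∫ _ in v..u, l v := by simp [mul_comm]
      _ ≤ _ := intervalIntegral.integral_mono_on hvu (by simp) hiu
        fun s hs => hl hvI ⟨hv.trans hs.1, hs.2.trans_lt hu⟩ hs.1
  · calc ∫ s in v..u, l s ≤ ∫ _ in v..u, l u :=
          intervalIntegral.integral_mono_on hvu hiu (by simp)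
            fun s hs => hl ⟨hv.trans hs.1, hs.2.trans_lt hu⟩ huI hs.2
      _ = l u * (u - v) := by simp [mul_comm]

/-! ### The Nelson-Aalen estimator on a fixed sample -/

theorem nelsonAalen_nonneg (n : ℕ) {T Δ : ℕ → ℝ} (hΔ : ∀ i, 0 ≤ Δ i) (t : ℝ) :
    0 ≤ nelsonAalen n T Δ t := by
  refine Finset.sum_nonneg fun i _ => div_nonneg (mul_nonneg ?_ (hΔ i))
    (Finset.sum_nonneg fun j _ => ?_) <;> split_ifs <;> norm_num

theorem monotone_nelsonAalen (n : ℕ) {T Δ : ℕ → ℝ} (hΔ : ∀ i, 0 ≤ Δ i) :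
    Monotone (nelsonAalen n T Δ) := by
  intro s t hst
  refine Finset.sum_le_sum fun i _ => ?_
  refine div_le_div_of_nonneg_right (mul_le_mul_of_nonneg_right ?_ (hΔ i))
    (Finset.sum_nonneg fun j _ => by split_ifs <;> norm_num)
  by_cases h : T i ≤ s
  · rw [if_pos h, if_pos (h.trans hst)]
  · rw [if_neg h]; split_ifs <;> norm_num

/-- The proportion of the first `n` follow-up times that are at least `s`. -/
noncomputable def atRiskFraction (n : ℕ) (T : ℕ → ℝ) (s : ℝ) : ℝ :=
  (∑ j ∈ Finset.range n, if s ≤ T j then (1 : ℝ) else 0) / n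

theorem antitone_atRiskFraction (n : ℕ) (T : ℕ → ℝ) : Antitone (atRiskFraction n T) := by
  intro s t hst
  refine div_le_div_of_nonneg_right (Finset.sum_le_sum fun j _ => ?_) n.cast_nonneg
  by_cases h : t ≤ T j
  · rw [if_pos h, if_pos (hst.trans h)]
  · rw [if_neg h]; split_ifs <;> norm_num

theorem nelsonAalen_eq (n : ℕ) (T Δ : ℕ → ℝ) (t : ℝ) :
    nelsonAalen n T Δ t =
      (∑ i ∈ Finset.range n, (if T i ≤ t then Δ i / atRiskFraction n T (T i) else 0)) / n := by
  rcases Nat.eq_zero_or_pos n with rfl | hn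
  · simp [nelsonAalen]
  rw [nelsonAalen, Finset.sum_div]
  refine Finset.sum_congr rfl fun i _ => ?_
  have : (n : ℝ) ≠ 0 := by positivity
  split_ifs
  · rw [atRiskFraction, one_mul, div_div, div_mul_cancel₀ _ this]
  · simp

/-- If the proportion at risk converges to `S` uniformly on `[0, t]`, where `S` is bounded below by
`c > 0`, then replacing it by `S` in the Nelson-Aalen estimator does not affect the limit. -/
theorem tendsto_nelsonAalen {T Δ : ℕ → ℝ} (hΔ0 : ∀ i, 0 ≤ Δ i) (hΔ1 : ∀ i, Δ i ≤ 1)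
    (hT : ∀ i, 0 ≤ T i) {S : ℝ → ℝ} {t c v : ℝ} (hc : 0 < c)
    (hS : ∀ s ∈ Set.Icc 0 t, c ≤ S s)
    (hunif : TendstoUniformlyOn (fun n => atRiskFraction n T) S atTop (Set.Icc 0 t))
    (hsum : Tendsto (fun n : ℕ =>
      (∑ i ∈ Finset.range n, (if T i ≤ t then Δ i / S (T i) else 0)) / n) atTop (𝓝 v)) :
    Tendsto (fun n => nelsonAalen n T Δ t) atTop (𝓝 v) := by
  have hdiff : Tendsto (fun n : ℕ => nelsonAalen n T Δ t -
      (∑ i ∈ Finset.range n, (if T i ≤ t then Δ i / S (T i) else 0)) / n) atTop (𝓝 0) := by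
    rw [Metric.tendsto_nhds]
    intro ε hε
    -- With `|S - Y| < c / 2` also `Y ≥ c / 2`, so `|1 / Y - 1 / S| ≤ |S - Y| / (c * (c / 2))`.
    have hη : 0 < min (c / 2) (ε * (c * (c / 2)) / 2) := by positivity
    filter_upwards [Metric.tendstoUniformlyOn_iff.1 hunif _ hη, eventually_gt_atTop 0] with n hn hn0
    have hn0' : (0 : ℝ) < n := by exact_mod_cast hn0
    rw [nelsonAalen_eq, ← sub_div, ← Finset.sum_sub_distrib, dist_zero_right, norm_div,
      Real.norm_natCast, div_lt_iff₀ hn0']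
    have hterm : ∀ i ∈ Finset.range n, ‖(if T i ≤ t then Δ i / atRiskFraction n T (T i) else 0) -
        (if T i ≤ t then Δ i / S (T i) else 0)‖ ≤ ε / 2 := by
      intro i _
      split_ifs with h
      · have hi : T i ∈ Set.Icc 0 t := ⟨hT i, h⟩
        have h1 := hn (T i) hi
        rw [lt_min_iff, Real.dist_eq] at h1
        obtain ⟨h1, h2⟩ := h1
        have hSi := hS (T i) hi
        have hY : c / 2 ≤ atRiskFraction n T (T i) := by linarith [(abs_lt.1 h1).2]
        set y := atRiskFraction n T (T i)
        have hS0 : 0 < S (T i) := hc.trans_le hSi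
        have hy0 : 0 < y := (half_pos hc).trans_le hY
        rw [div_sub_div _ _ hy0.ne' hS0.ne', Real.norm_eq_abs, abs_div,
          abs_of_pos (mul_pos hy0 hS0), div_le_iff₀ (mul_pos hy0 hS0),
          show Δ i * S (T i) - y * Δ i = Δ i * (S (T i) - y) by ring, abs_mul,
          abs_of_nonneg (hΔ0 i)]
        calc Δ i * |S (T i) - y| ≤ 1 * (ε * (c * (c / 2)) / 2) :=
              mul_le_mul (hΔ1 i) h2.le (abs_nonneg _) zero_le_one
          _ = ε / 2 * (c / 2 * c) := by ring
          _ ≤ ε / 2 * (y * S (T i)) := by gcongr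
      · rw [sub_self, norm_zero]
        exact (half_pos hε).le
    calc _ ≤ _ := norm_sum_le_of_le _ hterm
      _ = ε / 2 * n := by simp [mul_comm]
      _ < ε * n := by gcongr; linarith
  simpa using hdiff.add hsum

/-! ### Distribution functions and expectations under the law of a pair -/

theorem continuous_cdf (P : Measure ℝ) [IsProbabilityMeasure P] [NullSingletonClass P] :
    Continuous (cdf P) := by
  refine continuous_iff_continuousAt.2 fun x => ?_
  rw [(monotone_cdf P).continuousAt_iff_leftLim_eq_rightLim, StieltjesFunction.rightLim_eq]
  have h := (cdf P).measure_singleton x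
  rw [measure_cdf, measure_singleton, eq_comm, ENNReal.ofReal_eq_zero] at h
  exact le_antisymm ((monotone_cdf P).leftLim_le le_rfl) (by linarith)

theorem measureReal_Ici_eq (P : Measure ℝ) [IsProbabilityMeasure P] [NullSingletonClass P] (x : ℝ) :
    P.real (Set.Ici x) = 1 - cdf P x := by
  rw [measureReal_congr Ioi_ae_eq_Ici.symm, ← Set.compl_Iic,
    probReal_compl_eq_one_sub measurableSet_Iic, cdf_eq_real]

theorem cdf_lt_one_of_lt_upperEndpoint {P : Measure ℝ} {t : ℝ}
    (ht : (t : EReal) < upperEndpoint P) :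
    cdf P t < 1 := by
  obtain ⟨_, ⟨s, hs, rfl⟩, hts⟩ := lt_sSup_iff.1 ht
  exact (monotone_cdf P (EReal.coe_lt_coe_iff.1 hts).le).trans_lt hs

/-- The survival function `(1 - F)(1 - G)` of the minimum of two independent variables with laws `P`
and `Q`. -/
noncomputable def survival (P Q : Measure ℝ) (s : ℝ) : ℝ := (1 - cdf P s) * (1 - cdf Q s)

theorem antitone_survival (P Q : Measure ℝ) : Antitone (survival P Q) := fun s t hst =>
  mul_le_mul (by linarith [monotone_cdf P hst]) (by linarith [monotone_cdf Q hst])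
    (by linarith [cdf_le_one Q t]) (by linarith [cdf_le_one P s])

theorem integral_atRisk (P Q : Measure ℝ) [IsProbabilityMeasure P] [IsProbabilityMeasure Q]
    [NullSingletonClass P] [NullSingletonClass Q] (s : ℝ) :
    ∫ z : ℝ × ℝ, (if s ≤ followUp z.1 z.2 then (1 : ℝ) else 0) ∂P.prod Q = survival P Q s := by
  have h : (fun z : ℝ × ℝ => if s ≤ followUp z.1 z.2 then (1 : ℝ) else 0) =
      (Set.Ici s ×ˢ Set.Ici s).indicator 1 := by
    ext z
    simp only [followUp, le_min_iff, Set.indicator_apply, Set.mem_prod, Set.mem_Ici, Pi.one_apply]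
  rw [h, integral_indicator_one (measurableSet_Ici.prod measurableSet_Ici), measureReal_prod_prod,
    measureReal_Ici_eq, measureReal_Ici_eq, survival]

/-- The expectation of `1_{T ≤ t} Δ / S(T)` is the cumulative hazard at `t`: given `X = x`, the
probability `1 - G(x)` of no censoring cancels against the same factor of `S(x)`, which leaves
`1 / (1 - F(x))` to be integrated against the law of `X`. -/
theorem integral_uncensored_weight {P Q : Measure ℝ} [IsProbabilityMeasure P]
    [IsProbabilityMeasure Q] [NullSingletonClass P] [NullSingletonClass Q] {f : ℝ → ℝ}
    (hf : Measurable f) (hf0 : ∀ t, 0 ≤ f t)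
    (hP : P = volume.withDensity fun t => ENNReal.ofReal (f t)) (hP0 : ∀ᵐ x ∂P, 0 ≤ x)
    {t : ℝ} (ht : 0 ≤ t) (hQt : cdf Q t < 1)
    (hint : Integrable (fun z : ℝ × ℝ => if followUp z.1 z.2 ≤ t then
      censInd z.1 z.2 / survival P Q (followUp z.1 z.2) else 0) (P.prod Q)) :
    ∫ z : ℝ × ℝ, (if followUp z.1 z.2 ≤ t then
      censInd z.1 z.2 / survival P Q (followUp z.1 z.2) else 0) ∂P.prod Q =
      ∫ s in (0 : ℝ)..t, hazardRate P f s := by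
  rw [integral_prod _ hint]
  have hinner : ∀ x, ∫ y, (if followUp x y ≤ t then
      censInd x y / survival P Q (followUp x y) else 0) ∂Q =
      (Set.Iic t).indicator (fun x => (1 - cdf P x)⁻¹) x := by
    intro x
    have h : (fun y => if followUp x y ≤ t then
        censInd x y / survival P Q (followUp x y) else 0) =
        (Set.Ici x).indicator fun _ => if x ≤ t then (survival P Q x)⁻¹ else 0 := by
      ext y
      by_cases hxy : x ≤ y <;> simp [followUp, censInd, hxy]
    rw [h, integral_indicator_const _ measurableSet_Ici, measureReal_Ici_eq]
    by_cases hx : x ≤ t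
    · have : 1 - cdf Q x ≠ 0 := by linarith [monotone_cdf Q hx]
      rw [if_pos hx, Set.indicator_of_mem (by exact hx), survival, smul_eq_mul, mul_inv]
      field_simp
    · simp [hx]
  simp_rw [hinner]
  rw [integral_indicator measurableSet_Iic]
  have hae : (Set.Iic t : Set ℝ) =ᵐ[P] Set.Ioc 0 t := by
    filter_upwards [hP0, (Measure.ae_ne P 0)] with x hx hx0
    refine propext ⟨fun h => ⟨lt_of_le_of_ne hx (Ne.symm hx0), h⟩, fun h => h.2⟩
  rw [setIntegral_congr_set hae, intervalIntegral.integral_of_le ht]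
  rw [hP, setIntegral_withDensity_eq_setIntegral_toReal_smul hf.ennreal_ofReal
    (by simp) _ measurableSet_Ioc]
  refine integral_congr_ae (Eventually.of_forall fun x => ?_)
  simp only [hazardRate, smul_eq_mul, ENNReal.toReal_ofReal (hf0 x), div_eq_mul_inv]

/-! ### Almost sure convergence -/

section Probability

variable {Ω : Type*} [MeasurableSpace Ω] {μ : Measure Ω} [IsProbabilityMeasure μ]
  {X C : ℕ → Ω → ℝ} {P Q : Measure ℝ}

theorem strong_law_pairs (hX : ∀ i, Measurable (X i)) (hC : ∀ i, Measurable (C i))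
    (hP : ∀ i, μ.map (X i) = P) (hQ : ∀ i, μ.map (C i) = Q)
    (h_indep : iIndepFun (fun i ω => (X i ω, C i ω)) μ) (hXC : ∀ i, IndepFun (X i) (C i) μ)
    {φ : ℝ × ℝ → ℝ} (hφ : Measurable φ) (hint : Integrable φ (P.prod Q)) :
    ∀ᵐ ω ∂μ, Tendsto (fun n : ℕ => (∑ i ∈ Finset.range n, φ (X i ω, C i ω)) / n) atTop
      (𝓝 (∫ z, φ z ∂P.prod Q)) := by
  have hm : ∀ i, Measurable fun ω => (X i ω, C i ω) := fun i => (hX i).prodMk (hC i)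
  have hmap : ∀ i, μ.map (fun ω => (X i ω, C i ω)) = P.prod Q := fun i => by
    rw [(indepFun_iff_map_prod_eq_prod_map_map (hX i).aemeasurable (hC i).aemeasurable).1 (hXC i),
      hP, hQ]
  have hid : ∀ i, IdentDistrib (fun ω => φ (X i ω, C i ω)) (fun ω => φ (X 0 ω, C 0 ω)) μ μ :=
    fun i => IdentDistrib.comp ⟨(hm i).aemeasurable, (hm 0).aemeasurable, by rw [hmap, hmap]⟩ hφ
  have h := strong_law_ae_real (μ := μ) (fun i ω => φ (X i ω, C i ω))
    ((integrable_map_measure (by rw [hmap]; exact hint.1) (hm 0).aemeasurable).1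
      (by rwa [hmap])) (fun i j hij => (h_indep.indepFun hij).comp hφ hφ) hid
  rw [← hmap 0, integral_map (hm 0).aemeasurable hφ.aestronglyMeasurable]
  exact h

/-- The Glivenko-Cantelli theorem for the follow-up times. -/
theorem ae_tendstoLocallyUniformlyOn_atRiskFraction [NullSingletonClass P] [NullSingletonClass Q]
    (hX : ∀ i, Measurable (X i)) (hC : ∀ i, Measurable (C i))
    (hP : ∀ i, μ.map (X i) = P) (hQ : ∀ i, μ.map (C i) = Q)
    (h_indep : iIndepFun (fun i ω => (X i ω, C i ω)) μ) (hXC : ∀ i, IndepFun (X i) (C i) μ) :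
    ∀ᵐ ω ∂μ, TendstoLocallyUniformlyOn
      (fun n => atRiskFraction n fun i => followUp (X i ω) (C i ω)) (survival P Q) atTop
      Set.univ := by
  have : IsProbabilityMeasure P := hP 0 ▸ Measure.isProbabilityMeasure_map (hX 0).aemeasurable
  have : IsProbabilityMeasure Q := hQ 0 ▸ Measure.isProbabilityMeasure_map (hC 0).aemeasurable
  have hrat : ∀ᵐ ω ∂μ, ∀ q : ℚ, Tendsto
      (fun n => atRiskFraction n (fun i => followUp (X i ω) (C i ω)) q) atTop
      (𝓝 (survival P Q q)) := by
    refine ae_all_iff.2 fun q => ?_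
    have hms : MeasurableSet {z : ℝ × ℝ | (q : ℝ) ≤ followUp z.1 z.2} :=
      measurableSet_le measurable_const (measurable_fst.min measurable_snd)
    have hm : Measurable fun z : ℝ × ℝ => if (q : ℝ) ≤ followUp z.1 z.2 then (1 : ℝ) else 0 :=
      Measurable.ite hms measurable_const measurable_const
    rw [← integral_atRisk P Q q]
    refine strong_law_pairs hX hC hP hQ h_indep hXC hm ?_
    refine Integrable.of_bound hm.aestronglyMeasurable 1 (Eventually.of_forall fun z => ?_)
    split_ifs <;> simp
  filter_upwards [hrat] with ω hω
  have hcont : Continuous (survival P Q) :=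
    (continuous_const.sub (continuous_cdf P)).mul (continuous_const.sub (continuous_cdf Q))
  have h := tendstoLocallyUniformlyOn_of_monotoneOn (U := Set.univ) isOpen_univ
    Rat.denseRange_cast
    (h := fun n s => -atRiskFraction n (fun i => followUp (X i ω) (C i ω)) s)
    (l := fun s => -survival P Q s)
    (fun n => (antitone_atRiskFraction n _).neg.monotoneOn _) hcont.neg.continuousOn
    (by rintro _ ⟨-, q, rfl⟩; exact (hω q).neg)
  rw [Metric.tendstoLocallyUniformlyOn_iff] at h ⊢
  simpa only [dist_neg_neg] using h

/-- Pointwise strong consistency of the Nelson-Aalen estimator for the cumulative hazard. -/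
theorem ae_tendsto_nelsonAalen {f : ℝ → ℝ} [NullSingletonClass P] [NullSingletonClass Q]
    (hX : ∀ i, Measurable (X i)) (hC : ∀ i, Measurable (C i))
    (hX0 : ∀ i, ∀ᵐ ω ∂μ, 0 ≤ X i ω) (hC0 : ∀ i, ∀ᵐ ω ∂μ, 0 ≤ C i ω)
    (hP : ∀ i, μ.map (X i) = P) (hQ : ∀ i, μ.map (C i) = Q)
    (h_indep : iIndepFun (fun i ω => (X i ω, C i ω)) μ) (hXC : ∀ i, IndepFun (X i) (C i) μ)
    (hf : Measurable f) (hf0 : ∀ t, 0 ≤ f t)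
    (hPf : P = volume.withDensity fun t => ENNReal.ofReal (f t))
    {t : ℝ} (ht : 0 ≤ t) (hPt : cdf P t < 1) (hQt : cdf Q t < 1) :
    ∀ᵐ ω ∂μ, Tendsto (fun n => nelsonAalen n (fun i => followUp (X i ω) (C i ω))
        (fun i => censInd (X i ω) (C i ω)) t) atTop (𝓝 (∫ s in (0 : ℝ)..t, hazardRate P f s)) := by
  have : IsProbabilityMeasure P := hP 0 ▸ Measure.isProbabilityMeasure_map (hX 0).aemeasurable
  have : IsProbabilityMeasure Q := hQ 0 ▸ Measure.isProbabilityMeasure_map (hC 0).aemeasurable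
  have hc : 0 < survival P Q t := mul_pos (by linarith) (by linarith)
  have hmin : Measurable fun z : ℝ × ℝ => followUp z.1 z.2 := measurable_fst.min measurable_snd
  have hm : Measurable fun z : ℝ × ℝ => if followUp z.1 z.2 ≤ t then
      censInd z.1 z.2 / survival P Q (followUp z.1 z.2) else 0 := by
    refine Measurable.ite (measurableSet_le hmin measurable_const) (Measurable.div ?_ ?_)
      measurable_const
    · exact Measurable.ite (measurableSet_le measurable_fst measurable_snd) measurable_const
        measurable_const
    · exact (antitone_survival P Q).measurable.comp hmin
  have hint : Integrable (fun z : ℝ × ℝ => if followUp z.1 z.2 ≤ t then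
      censInd z.1 z.2 / survival P Q (followUp z.1 z.2) else 0) (P.prod Q) := by
    refine Integrable.of_bound hm.aestronglyMeasurable (survival P Q t)⁻¹
      (Eventually.of_forall fun z => ?_)
    split_ifs with h
    · have hS := antitone_survival P Q h
      rw [Real.norm_eq_abs, abs_div, abs_of_pos (hc.trans_le hS), ← one_div]
      refine div_le_div₀ zero_le_one ?_ hc hS
      rw [censInd]; split_ifs <;> simp
    · simpa using hc.le
  have hslln := strong_law_pairs hX hC hP hQ h_indep hXC hm hint
  rw [integral_uncensored_weight hf hf0 hPf
    (by rw [← hP 0, ae_map_iff (hX 0).aemeasurable measurableSet_Ici]; exact hX0 0)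
    ht hQt hint] at hslln
  filter_upwards [hslln, ae_tendstoLocallyUniformlyOn_atRiskFraction hX hC hP hQ h_indep hXC,
    ae_all_iff.2 hX0, ae_all_iff.2 hC0] with ω h1 h2 h3 h4
  refine tendsto_nelsonAalen (S := survival P Q) (fun i => ?_) (fun i => ?_)
    (fun i => le_min (h3 i) (h4 i)) hc (fun s hs => antitone_survival P Q hs.2) ?_ h1
  · rw [censInd]; split_ifs <;> simp
  · rw [censInd]; split_ifs <;> simp
  · exact (tendstoLocallyUniformlyOn_iff_tendstoUniformlyOn_of_compact isCompact_Icc).1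
      (h2.mono (Set.subset_univ _))

end Probability

/-! ### Kernel smoothing -/

theorem integral_scaledKernel {k : ℝ → ℝ} (hk : IsKernel k) {b : ℝ} (hb : 0 < b) (x : ℝ) :
    ∫ u in (x - b)..(x + b), scaledKernel k b (x - u) = 1 := by
  have h1 : ∫ v in (-1 : ℝ)..1, k v = 1 := by
    rw [intervalIntegral.integral_of_le (by norm_num), ← integral_Icc_eq_integral_Ioc,
      setIntegral_eq_integral_of_forall_compl_eq_zero, hk.integral_eq_one]
    intro v hv
    by_contra h
    exact hv (hk.support_subset h)
  rw [intervalIntegral.integral_comp_sub_left (scaledKernel k b) x]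
  simp only [scaledKernel, intervalIntegral.integral_const_mul]
  rw [intervalIntegral.integral_comp_div k hb.ne', sub_sub_cancel, sub_add_cancel_left, neg_div,
    div_self hb.ne', h1]
  simp [hb.ne']

theorem integrable_scaledKernel {k : ℝ → ℝ} (hk : IsKernel k) {b : ℝ} (hb : 0 < b) (x : ℝ) :
    Integrable fun u => scaledKernel k b (x - u) :=
  ((hk.integrable.comp_div hb.ne').const_mul (1 / b)).comp_sub_left x

/-- A kernel average of values within `η` of `c` is within `η` of `c`. Monotonicity of `h` serves
only for measurability. -/
theorem abs_integral_scaledKernel_mul_sub_le {k : ℝ → ℝ} (hk : IsKernel k) {b : ℝ} (hb : 0 < b)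
    {h : ℝ → ℝ} {x c η : ℝ} (hh : MonotoneOn h (Set.Icc (x - b) (x + b)))
    (hη : ∀ u ∈ Set.Icc (x - b) (x + b), |h u - c| ≤ η) :
    |(∫ u in (x - b)..(x + b), scaledKernel k b (x - u) * h u) - c| ≤ η := by
  have hle : x - b ≤ x + b := by linarith
  have hki : IntervalIntegrable (fun u => scaledKernel k b (x - u)) volume (x - b) (x + b) :=
    (integrable_scaledKernel hk hb x).intervalIntegrable
  have hprod : IntervalIntegrable (fun u => scaledKernel k b (x - u) * h u) volume
      (x - b) (x + b) := by
    rw [intervalIntegrable_iff_integrableOn_Icc_of_le hle] at hki ⊢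
    refine Integrable.mul_bdd (c := |c| + η) hki
      (aemeasurable_restrict_of_monotoneOn measurableSet_Icc hh).aestronglyMeasurable
      (ae_restrict_of_forall_mem measurableSet_Icc fun u hu => ?_)
    calc ‖h u‖ = |c + (h u - c)| := by simp
      _ ≤ |c| + |h u - c| := abs_add_le _ _
      _ ≤ |c| + η := by gcongr; exact hη u hu
  have hc : c = ∫ u in (x - b)..(x + b), scaledKernel k b (x - u) * c := by
    rw [intervalIntegral.integral_mul_const, integral_scaledKernel hk hb, one_mul]
  have hk0 : ∀ u, 0 ≤ scaledKernel k b (x - u) := fun u =>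
    mul_nonneg (by positivity) (hk.nonneg _)
  calc |(∫ u in (x - b)..(x + b), scaledKernel k b (x - u) * h u) - c|
      = |∫ u in (x - b)..(x + b), scaledKernel k b (x - u) * (h u - c)| := by
        simp_rw [mul_sub]
        rw [intervalIntegral.integral_sub hprod (hki.mul_const c), ← hc]
    _ ≤ ∫ u in (x - b)..(x + b), scaledKernel k b (x - u) * η := by
        rw [← Real.norm_eq_abs]
        refine intervalIntegral.norm_integral_le_of_norm_le hle
          (Eventually.of_forall fun u hu => ?_) (hki.mul_const η)
        rw [Real.norm_eq_abs, abs_mul, abs_of_nonneg (hk0 u)]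
        exact mul_le_mul_of_nonneg_left (hη u ⟨hu.1.le, hu.2⟩) (hk0 u)
    _ = η := by rw [intervalIntegral.integral_mul_const, integral_scaledKernel hk hb, one_mul]

/-- Away from the end points, smoothing with vanishing bandwidth preserves locally uniform
convergence to a continuous limit. The limits of integration `0` and `τ` are eventually inactive. -/
theorem tendstoUniformlyOn_smoothing {k : ℝ → ℝ} (hk : IsKernel k) {b : ℕ → ℝ}
    (hb_pos : ∀ n, 1 ≤ n → 0 < b n) (hb : Tendsto b atTop (𝓝 0)) {τ : ℝ}
    {h : ℕ → ℝ → ℝ} {l : ℝ → ℝ} (hmono : ∀ n, MonotoneOn (h n) (Set.Ioo 0 τ))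
    (hl : ContinuousOn l (Set.Ioo 0 τ)) (hlim : TendstoLocallyUniformlyOn h l atTop (Set.Ioo 0 τ))
    {ε : ℝ} (hε : 0 < ε) :
    TendstoUniformlyOn (fun n x => ∫ u in (max (x - b n) 0)..(min (x + b n) τ),
      scaledKernel k (b n) (x - u) * h n u) l atTop (Set.Icc ε (τ - ε)) := by
  have hKsub : Set.Icc (ε / 2) (τ - ε / 2) ⊆ Set.Ioo 0 τ := fun u hu =>
    ⟨by linarith [hu.1], by linarith [hu.2]⟩
  have hunif := (tendstoLocallyUniformlyOn_iff_tendstoUniformlyOn_of_compact isCompact_Icc).1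
    (hlim.mono hKsub)
  have huc := isCompact_Icc.uniformContinuousOn_of_continuous (hl.mono hKsub)
  rw [Metric.tendstoUniformlyOn_iff] at hunif ⊢
  rw [Metric.uniformContinuousOn_iff] at huc
  intro η hη
  obtain ⟨δ, hδ, hmod⟩ := huc (η / 4) (by linarith)
  filter_upwards [hunif (η / 4) (by linarith), eventually_ge_atTop 1,
    (tendsto_order.1 hb).2 (min δ (ε / 2)) (by positivity)] with n hn hn1 hbn x hx
  rw [lt_min_iff] at hbn
  have hb0 := hb_pos n hn1
  have hsub : Set.Icc (x - b n) (x + b n) ⊆ Set.Icc (ε / 2) (τ - ε / 2) := fun u hu =>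
    ⟨by linarith [hu.1, hx.1], by linarith [hu.2, hx.2]⟩
  have hxK : x ∈ Set.Icc (ε / 2) (τ - ε / 2) := ⟨by linarith [hx.1], by linarith [hx.2]⟩
  rw [max_eq_left (by linarith [hx.1]), min_eq_left (by linarith [hx.2]), dist_comm, Real.dist_eq]
  refine (abs_integral_scaledKernel_mul_sub_le hk hb0 (η := η / 2)
    ((hmono n).mono (hsub.trans hKsub)) fun u hu => ?_).trans_lt (by linarith)
  have h1 := hn u (hsub hu)
  have h2 := hmod u (hsub hu) x hxK (by
    rw [Real.dist_eq, abs_lt]; constructor <;> linarith [hu.1, hu.2])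
  rw [dist_comm] at h1
  rw [← Real.dist_eq]
  linarith [dist_triangle (h n u) (l u) (l x)]

end RightCensoring

theorem mainTheorem6
    {Ω : Type*} [MeasurableSpace Ω] (μ : Measure Ω) [IsProbabilityMeasure μ]
    -- survival times `X i` with density `f`, censoring times `C i` with density `g`
    (X C : ℕ → Ω → ℝ) (f g : ℝ → ℝ)
    (hX : ∀ i, Measurable (X i)) (hC : ∀ i, Measurable (C i))
    (hX_nonneg : ∀ i, ∀ᵐ ω ∂μ, 0 ≤ X i ω) (hC_nonneg : ∀ i, ∀ᵐ ω ∂μ, 0 ≤ C i ω)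
    (hf : Measurable f) (hf_nonneg : ∀ t, 0 ≤ f t)
    (hg : Measurable g) (hg_nonneg : ∀ t, 0 ≤ g t)
    (hX_law : ∀ i, μ.map (X i) = volume.withDensity (fun t => ENNReal.ofReal (f t)))
    (hC_law : ∀ i, μ.map (C i) = volume.withDensity (fun t => ENNReal.ofReal (g t)))
    -- the pairs are independent of each other, and within each pair `X i`, `C i` are independent
    (h_indep : iIndepFun (fun i ω => (X i ω, C i ω)) μ)
    (hXC : ∀ i, IndepFun (X i) (C i) μ)
    -- end points of the supports: `τ = τ_H = τ_G < τ_F ≤ ∞`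
    (τ : ℝ)
    (hτ_H : RightCensoring.upperEndpoint
      (μ.map (fun ω => RightCensoring.followUp (X 0 ω) (C 0 ω))) = (τ : EReal))
    (hτ_G : RightCensoring.upperEndpoint (μ.map (C 0)) = (τ : EReal))
    (hτ_F : (τ : EReal) < RightCensoring.upperEndpoint (μ.map (X 0)))
    -- the kernel and the bandwidths
    (k : ℝ → ℝ) (hk : RightCensoring.IsKernel k)
    (b : ℕ → ℝ) (hb_pos : ∀ n, 1 ≤ n → 0 < b n) (hb : Tendsto b atTop (𝓝 0))
    (hnb : Tendsto (fun n : ℕ => (n : ℝ) * b n) atTop atTop)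
    -- the hazard rate is nondecreasing and continuous
    (h_mono : MonotoneOn (RightCensoring.hazardRate (μ.map (X 0)) f) (Set.Ico 0 τ))
    (h_cont : ContinuousOn (RightCensoring.hazardRate (μ.map (X 0)) f) (Set.Ico 0 τ)) :
    ∀ ε : ℝ, 0 < ε → ε < τ →
      ∀ᵐ ω ∂μ,
        TendstoUniformlyOn
          (fun (n : ℕ) (x : ℝ) =>
            RightCensoring.smoothedGrenander k (b n) τ n
              (fun i => RightCensoring.followUp (X i ω) (C i ω))
              (fun i => RightCensoring.censInd (X i ω) (C i ω)) x)
          (RightCensoring.hazardRate (μ.map (X 0)) f)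
          atTop (Set.Icc ε (τ - ε)) := by
  open RightCensoring in
  intro ε hε _
  set P := μ.map (X 0) with hPdef
  set Q := μ.map (C 0) with hQdef
  have hP : ∀ i, μ.map (X i) = P := fun i => (hX_law i).trans (hX_law 0).symm
  have hQ : ∀ i, μ.map (C i) = Q := fun i => (hC_law i).trans (hC_law 0).symm
  have hPf : P = volume.withDensity fun t => ENNReal.ofReal (f t) := hX_law 0
  have hPa : NullSingletonClass P := hPf ▸ nullSingletonClass_withDensity _
  have hQa : NullSingletonClass Q := by
    have : Q = volume.withDensity fun t => ENNReal.ofReal (g t) := hC_law 0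
    exact this ▸ nullSingletonClass_withDensity _
  have hPt : ∀ t < τ, cdf P t < 1 := fun t ht =>
    cdf_lt_one_of_lt_upperEndpoint ((EReal.coe_lt_coe_iff.2 ht).trans hτ_F)
  have hQt : ∀ t < τ, cdf Q t < 1 := fun t ht =>
    cdf_lt_one_of_lt_upperEndpoint (hτ_G ▸ EReal.coe_lt_coe_iff.2 ht)
  -- Rational points suffice and allow a single exceptional null set.
  have hNA : ∀ᵐ ω ∂μ, ∀ q : ℚ, (q : ℝ) ∈ Set.Ico 0 τ →
      Tendsto (fun n => nelsonAalen n (fun i => followUp (X i ω) (C i ω))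
        (fun i => censInd (X i ω) (C i ω)) q) atTop
        (𝓝 (∫ s in (0 : ℝ)..q, hazardRate P f s)) := by
    refine ae_all_iff.2 fun q => ?_
    by_cases hq : (q : ℝ) ∈ Set.Ico 0 τ
    · filter_upwards [ae_tendsto_nelsonAalen hX hC hX_nonneg hC_nonneg hP hQ h_indep hXC hf
        hf_nonneg hPf hq.1 (hPt q hq.2) (hQt q hq.2)] with ω hω _ using hω
    · exact Eventually.of_forall fun ω h => absurd h hq
  have hcont : ContinuousOn (hazardRate P f) (Set.Ioo 0 τ) := h_cont.mono Set.Ioo_subset_Ico_self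
  filter_upwards [hNA] with ω hω
  have hΔ : ∀ i, 0 ≤ censInd (X i ω) (C i ω) := fun i => by
    rw [censInd]; split_ifs <;> norm_num
  refine tendstoUniformlyOn_smoothing hk hb_pos hb (fun n => monotoneOn_leftSlope
    (convexOn_greatestConvexMinorant (fun t _ => nelsonAalen_nonneg n hΔ t) (convex_Icc 0 τ)))
    hcont ?_ hε
  refine tendstoLocallyUniformlyOn_leftSlope (D := Set.range ((↑) : ℚ → ℝ)) Rat.denseRange_cast
    ⟨0, Rat.cast_zero⟩ (fun n => nelsonAalen_nonneg n hΔ) (fun n => monotone_nelsonAalen n hΔ)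
    (fun t ht => div_nonneg (hf_nonneg t) (by linarith [hPt t ht.2])) hcont
    (fun v u hv hvu hu => integral_bounds_of_monotoneOn h_mono hv hvu hu) ?_
  rintro _ ⟨hq, q, rfl⟩
  exact hω q hq
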